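/- Let $d\in\mathbb{N}$ and $S\subseteq\mathbb{R}^d$. A set $L\subseteq\mathbb{R}^d$ is called $S$-free if it is closed and convex and its interior is disjoint from $S$; it is maximal $S$-free if it is not properly contained in another $S$-free set. Define $f(S)\in\{-\infty\}\cup\mathbb{N}_0\cup\{+\infty\}$ as follows: $f(S)=-\infty$ if there is no $d$-dimensional maximal $S$-free set; otherwise $f(S)$ is the least $k\in\mathbb{N}_0$ such that every $d$-dimensional maximal $S$-free set is a polyhedron with at most $k$ facets, and $f(S)=+\infty$ if no such $k$ exists. Define $h(S)\in\mathbb{N}_0\cup\{+\infty\}$ to be the Helly number of the family $\mathcal{F}=\{S\cap K : K\subseteq\mathbb{R}^d\text{ convex}\}$, that is: $h(S)=0$ if $\mathcal{F}=\{\emptyset\}$ (equivalently $S=\emptyset$); otherwise $h(S)$ is the least $k\geq 1$ such that, for all $m\ge 1$ and all $F_1,\dots,F_m\in\mathcal{F}$ with $F_1\cap\dots\cap F_m=\emptyset$, there are $i_1,\dots,i_k\in\{1,\dots,m\}$ (not necessarily distinct) with $F_{i_1}\cap\dots\cap F_{i_k}=\emptyset$, and $h(S)=+\infty$ if no such $k$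 exists. Theorem. Let $C,D\subseteq\mathbb{R}^d$ be nonempty convex sets and let $\Lambda\subseteq\mathbb{R}^d$ be a lattice, i.e. a discrete subgroup of the additive group $\mathbb{R}^d$ (not necessarily of full rank). Let $C+\Lambda=\{c+\lambda : c\in C,\ \lambda\in\Lambda\}$, let $\dim C$ be the dimension of the affine hull of $C$, and let $\operatorname{rank}\Lambda$ be the rank of $\Lambda$ as a free abelian group. Then $$h\bigl((C+\Lambda)\cap D\bigr)\le(\dim C+1)\,2^{\operatorname{rank}\Lambda} \qquad\text{and}\qquad f\bigl((C+\Lambda)\cap D\bigr)\le 2^{\operatorname{rank}\Lambda}.$$ -/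

import Mathlib

open scoped Pointwise

noncomputable section

/-- The dimension of a nonempty set in `ℝ^d`: the dimension of its affine hull. -/
def affDim {d : ℕ} (A : Set (EuclideanSpace ℝ (Fin d))) : ℕ :=
  Module.finrank ℝ (vectorSpan ℝ A)

/-- `A` is a `d`-dimensional subset of `ℝ^d`. -/
def IsFullDim {d : ℕ} (A : Set (EuclideanSpace ℝ (Fin d))) : Prop :=
  A.Nonempty ∧ affDim A = d

/-- A polyhedron: the solution set of a finite system of linear inequalities. -/
def IsPolyhedron {d : ℕ} (P : Set (EuclideanSpace ℝ (Fin d))) : Prop :=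
  ∃ (m : ℕ) (u : Fin m → EuclideanSpace ℝ (Fin d)) (β : Fin m → ℝ),
    P = {x | ∀ i, inner ℝ (u i) x ≤ β i}

/-- `F` is a facet of the polyhedron `P`: a nonempty face of `P` whose dimension is one less
than the dimension of `P`. Nonempty faces are the nonempty sets of maximizers over `P` of linear
functionals. -/
def IsFacet {d : ℕ} (P F : Set (EuclideanSpace ℝ (Fin d))) : Prop :=
  F.Nonempty ∧ IsExposed ℝ P F ∧ affDim F + 1 = affDim P

/-- `L` is `S`-free: closed, convex, with interior disjoint from `S`. -/
def IsSFree {d : ℕ} (S L : Set (EuclideanSpace ℝ (Fin d))) : Prop :=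
  IsClosed L ∧ Convex ℝ L ∧ Disjoint (interior L) S

/-- `L` is an inclusion-maximal `S`-free set. -/
def IsMaximalSFree {d : ℕ} (S L : Set (EuclideanSpace ℝ (Fin d))) : Prop :=
  Maximal (IsSFree S) L

/-- Every `d`-dimensional maximal `S`-free set is a polyhedron with at most `k` facets. -/
def FacetBound {d : ℕ} (S : Set (EuclideanSpace ℝ (Fin d))) (k : ℕ) : Prop :=
  ∀ L, IsMaximalSFree S L → IsFullDim L →
    IsPolyhedron L ∧ {F | IsFacet L F}.encard ≤ (k : ℕ∞)

open Classical in
/-- The functional `f`: it is `-∞` if there is no `d`-dimensional maximal `S`-free set, otherwise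
the least `k ∈ ℕ₀` such that every `d`-dimensional maximal `S`-free set is a polyhedron with at
most `k` facets, and `+∞` if there is no such `k`. -/
def facetComplexity {d : ℕ} (S : Set (EuclideanSpace ℝ (Fin d))) : WithBot ℕ∞ :=
  if ∃ L, IsMaximalSFree S L ∧ IsFullDim L then
    ((⨅ (k : ℕ) (_ : FacetBound S k), (k : ℕ∞) : ℕ∞) : WithBot ℕ∞)
  else ⊥

/-- Whenever finitely many members of the family have empty intersection, some `k` of them
(repetitions allowed) have empty intersection. -/
def HellyProp {α : Type*} (𝓕 : Set (Set α)) (k : ℕ) : Prop :=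
  ∀ (m : ℕ), 1 ≤ m → ∀ F : Fin m → Set α, (∀ i, F i ∈ 𝓕) → ⋂ i, F i = ∅ →
    ∃ j : Fin k → Fin m, ⋂ i, F (j i) = ∅

open Classical in
/-- The Helly number of a nonempty family of sets: `0` for the family `{∅}`, otherwise the least
`k ≥ 1` with the Helly property, and `+∞` if there is no such `k`. -/
def hellyNumber {α : Type*} (𝓕 : Set (Set α)) : ℕ∞ :=
  if 𝓕 = {∅} then 0 else ⨅ (k : ℕ) (_ : 1 ≤ k ∧ HellyProp 𝓕 k), (k : ℕ∞)

/-- The functional `h`: the Helly number of the family of `S`-convex sets, that is, of the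
intersections of `S` with convex sets. -/
def sConvexHelly {d : ℕ} (S : Set (EuclideanSpace ℝ (Fin d))) : ℕ∞ :=
  hellyNumber {A | ∃ C : Set (EuclideanSpace ℝ (Fin d)), Convex ℝ C ∧ A = S ∩ C}

end

/-! ### Covering a midpoint-closed finite set by half-spaces -/

section FiniteCover

variable {E : Type*} [NormedAddCommGroup E] [NormedSpace ℝ E]

/-! Both bounds rest on parity: two points of `Λ` congruent mod `2Λ` have their midpoint in `Λ`, and
there are `2 ^ rank` classes. By `exists_subcover_card_le`, a half-space cover of a finite
midpoint-closed set needs at most one half-space per class.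

For `h`, this gives Doignon's theorem for `Λ` (`AddSubgroup.doignon`). Helly's theorem inside each
translate `C + l` selects `dim C + 1` sets; Doignon's theorem, applied to families indexed by such
selections, leaves `2 ^ rank` selections serving all `l` at once.

For `f`, compactness turns the finite covers into a cover of all of `Λ` by `2 ^ rank` convex sets
missing `(interior L ∩ D) - C`. Adding `C` and intersecting with `D` covers `S` by convex sets
missing `interior L`; separating each from `L` and using maximality yields one inequality per class.
-/

/-- A finite cover of a finite set `S`, closed under midpoints of points of the same class, by
sets that are upward closed with respect to linear functionals has a subcover with at most as many
members as there are classes. -/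
theorem exists_subcover_card_le {ι κ : Type*} [Fintype ι] [Fintype κ] (S : Finset E) (π : E → κ)
    (hmid : ∀ p ∈ S, ∀ q ∈ S, π p = π q → midpoint ℝ p q ∈ S) (a : ι → StrongDual ℝ E)
    (T : ι → Finset E) (hTS : ∀ i, T i ⊆ S)
    (hup : ∀ i, ∀ s ∈ T i, ∀ t ∈ S, a i s ≤ a i t → t ∈ T i)
    (hcov : ∀ s ∈ S, ∃ i, s ∈ T i) :
    ∃ J : Finset ι, J.card ≤ Fintype.card κ ∧ ∀ s ∈ S, ∃ i ∈ J, s ∈ T i := by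
  classical
  induction hn : ∑ i, (T i).card using Nat.strong_induction_on generalizing T with
  | _ n ih =>
  by_contra hcon
  have key : ∀ i, (T i).Nonempty →
      ∃ p ∈ T i, (∀ t ∈ T i, a i p ≤ a i t) ∧ ∀ j, j ≠ i → p ∉ T j := by
    intro i hi
    obtain ⟨s₀, hs₀, hmin⟩ := Finset.exists_min_image (T i) (a i) hi
    -- Discard the minimal level of `T i`. If the rest still covered `S`, induction would apply; so
    -- some minimal point of `T i` lies in no other member.
    let T' := Function.update T i ((T i).filter fun s => a i s₀ < a i s)
    have hT'i : T' i = (T i).filter fun s => a i s₀ < a i s := by simp [T']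
    have hT'j : ∀ j, j ≠ i → T' j = T j := fun j hj => by simp [T', hj]
    have hle : ∀ j, T' j ⊆ T j := by
      intro j
      by_cases hj : j = i
      · subst hj; rw [hT'i]; exact Finset.filter_subset _ _
      · rw [hT'j j hj]
    have hnc : ¬ ∀ s ∈ S, ∃ j, s ∈ T' j := by
      intro hc
      have hlt : ∑ j, (T' j).card < n := by
        rw [← hn]
        refine Finset.sum_lt_sum (fun j _ => Finset.card_le_card (hle j))
          ⟨i, Finset.mem_univ _, Finset.card_lt_card ?_⟩
        refine (Finset.ssubset_iff_of_subset (hle i)).2 ⟨s₀, hs₀, ?_⟩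
        rw [hT'i]; simp
      obtain ⟨J, hJ, hJc⟩ := ih _ hlt T' (fun j => (hle j).trans (hTS j)) (by
        intro j s hs t ht hst
        by_cases hj : j = i
        · subst hj
          rw [hT'i, Finset.mem_filter] at hs ⊢
          exact ⟨hup j s hs.1 t ht hst, hs.2.trans_le hst⟩
        · rw [hT'j j hj] at hs ⊢
          exact hup j s hs t ht hst) hc rfl
      exact hcon ⟨J, hJ, fun s hs => (hJc s hs).imp fun j h => ⟨h.1, hle j h.2⟩⟩
    push Not at hnc
    obtain ⟨p, hpS, hp⟩ := hnc
    have hpj : ∀ j, j ≠ i → p ∉ T j := fun j hj => by rw [← hT'j j hj]; exact hp j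
    obtain ⟨k, hk⟩ := hcov p hpS
    have hki : k = i := by
      by_contra hki
      exact hpj k hki hk
    subst hki
    refine ⟨p, hk, fun t ht => ?_, hpj⟩
    have h1 := hp k
    rw [hT'i, Finset.mem_filter] at h1
    have h2 : a k p ≤ a k s₀ := not_lt.1 fun h => h1 ⟨hk, h⟩
    exact h2.trans (hmin t ht)
  set J : Finset ι := Finset.univ.filter fun i => (T i).Nonempty with hJ
  have hJc : Fintype.card κ < J.card := by
    by_contra hlt
    refine hcon ⟨J, not_lt.1 hlt, fun s hs => ?_⟩
    obtain ⟨i, hi⟩ := hcov s hs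
    exact ⟨i, by simpa [hJ] using ⟨s, hi⟩, hi⟩
  have hne : ∀ i, ∃ p, i ∈ J → p ∈ T i ∧ (∀ t ∈ T i, a i p ≤ a i t) ∧ ∀ j, j ≠ i → p ∉ T j := by
    intro i
    by_cases hi : i ∈ J
    · obtain ⟨p, h1, h2⟩ := key i (by simpa [hJ] using hi)
      exact ⟨p, fun _ => ⟨h1, h2⟩⟩
    · exact ⟨0, fun h => (hi h).elim⟩
  choose p hp using hne
  obtain ⟨i, hi, j, hj, hij, hπ⟩ := Finset.exists_ne_map_eq_of_card_lt_of_maps_to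
    (s := J) (t := (Finset.univ : Finset κ)) (f := fun i => π (p i)) (by simpa using hJc)
    (fun _ _ => Finset.mem_univ _)
  obtain ⟨hi1, hi2, hi3⟩ := hp i hi
  obtain ⟨hj1, hj2, hj3⟩ := hp j hj
  have hiS := hTS i hi1
  have hjS := hTS j hj1
  have hq := hmid _ hiS _ hjS hπ
  obtain ⟨k, hk⟩ := hcov _ hq
  have hval : a k (midpoint ℝ (p i) (p j)) = (a k (p i) + a k (p j)) / 2 := by
    rw [midpoint_eq_smul_add, map_smul, map_add, smul_eq_mul, invOf_eq_inv]; ring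
  -- The midpoint lies in some `T k`, so points of `S` outside `T k` have strictly smaller `a
  -- k`-value. At least one of `p i`, `p j` is outside, and the other is outside or minimal in `T
  -- k`, so their average falls below the midpoint's value.
  have hlow : ∀ x ∈ S, x ∉ T k → a k x < a k (midpoint ℝ (p i) (p j)) := fun x hx hxk =>
    not_le.1 fun h => hxk (hup k _ hk x hx h)
  by_cases hki : k = i
  · subst hki
    have h1 := hlow _ hjS (hj3 k hij)
    have h2 := hi2 _ hk
    linarith
  by_cases hkj : k = j
  · subst hkj
    have h1 := hlow _ hiS (hi3 k hki)
    have h2 := hj2 _ hk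
    linarith
  have h1 := hlow _ hiS (hi3 k hki)
  have h2 := hlow _ hjS (hj3 k hkj)
  linarith

theorem Finset.exists_fin_map_of_card_le {α : Type*} [Nonempty α] {J : Finset α} {N : ℕ}
    (h : J.card ≤ N) : ∃ φ : Fin N → α, ∀ x ∈ J, ∃ k, φ k = x := by
  classical
  refine ⟨fun k => if hk : (k : ℕ) < J.card then J.equivFin.symm ⟨k, hk⟩
    else Classical.arbitrary α, fun x hx => ?_⟩
  refine ⟨⟨J.equivFin ⟨x, hx⟩, (J.equivFin ⟨x, hx⟩).2.trans_le h⟩, ?_⟩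
  simp

/-- A finite set `S`, closed under midpoints of points of the same class, that misses the
intersection of some compact convex sets can be covered by few convex sets, each missing one of the
given sets. -/
theorem exists_convex_cover_finset {ι : Type*} [Nonempty ι] {N : ℕ} (S : Finset E)
    (π : E → Fin N) (hmid : ∀ p ∈ S, ∀ q ∈ S, π p = π q → midpoint ℝ p q ∈ S) (M : ι → Set E)
    (hM : ∀ i, Convex ℝ (M i)) (hMc : ∀ i, IsCompact (M i)) (hS : ∀ s ∈ S, ∃ i, s ∉ M i) :
    ∃ (φ : Fin N → ι) (A : Fin N → Set E),
      (∀ k, Convex ℝ (A k)) ∧ (∀ k, Disjoint (A k) (M (φ k))) ∧ ∀ s ∈ S, ∃ k, s ∈ A k := by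
  classical
  obtain rfl | hSne := S.eq_empty_or_nonempty
  · exact ⟨fun _ => Classical.arbitrary ι, fun _ => ∅, fun _ => convex_empty,
      fun _ => Set.empty_disjoint _, by simp⟩
  have : Nonempty S := hSne.to_subtype
  have hsep : ∀ s : S, ∃ (i : ι) (a : StrongDual ℝ E), ∀ x ∈ M i, a x < a s := by
    intro s
    obtain ⟨i, hi⟩ := hS s s.2
    obtain ⟨a, u, h1, h2⟩ := geometric_hahn_banach_closed_point (hM i) (hMc i).isClosed hi
    exact ⟨i, a, fun x hx => (h1 x hx).trans h2⟩
  choose i a ha using hsep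
  obtain ⟨J, hJ, hJc⟩ := exists_subcover_card_le S π hmid a
    (fun s => S.filter fun t => a s s ≤ a s t) (fun s => Finset.filter_subset _ _)
    (fun s x hx t ht hxt => by
      rw [Finset.mem_filter] at hx ⊢
      exact ⟨ht, hx.2.trans hxt⟩)
    (fun s hs => ⟨⟨s, hs⟩, by simp [hs]⟩)
  rw [Fintype.card_fin] at hJ
  obtain ⟨φ, hφ⟩ := Finset.exists_fin_map_of_card_le hJ
  refine ⟨fun k => i (φ k), fun k => {t | a (φ k) (φ k) ≤ a (φ k) t}, fun k => ?_, fun k => ?_,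
    fun s hs => ?_⟩
  · exact convex_halfSpace_ge (a (φ k)).isLinear _
  · rw [Set.disjoint_left]
    intro x hx hxM
    exact absurd (ha _ x hxM) (not_lt.2 hx)
  · obtain ⟨t, htJ, ht⟩ := hJc s hs
    obtain ⟨k, rfl⟩ := hφ t htJ
    exact ⟨k, (Finset.mem_filter.1 ht).2⟩

end FiniteCover

/-! ### Parity, Doignon's theorem and convex covers of discrete subgroups -/

section Lattice

variable {E : Type*} [NormedAddCommGroup E] [NormedSpace ℝ E] [FiniteDimensional ℝ E]

/-- The classes are the coordinates mod 2 in a `ℤ`-basis: if `p` and `q` agree there, `p + q` is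
twice an element of `Λ`. -/
theorem AddSubgroup.exists_parity_map (Λ : AddSubgroup E) [DiscreteTopology Λ] :
    ∃ π : E → (Fin (2 ^ Module.finrank ℤ Λ)), ∀ p ∈ Λ, ∀ q ∈ Λ, π p = π q →
      midpoint ℝ p q ∈ Λ := by
  classical
  have hd : DiscreteTopology (AddSubgroup.toIntSubmodule Λ) := ‹DiscreteTopology Λ›
  have hf : Module.Finite ℤ Λ := instModuleFinite_of_discrete_submodule (AddSubgroup.toIntSubmodule Λ)
  have hfr : Module.Free ℤ Λ := instModuleFree_of_discrete_submodule (AddSubgroup.toIntSubmodule Λ)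
  let b := Module.finBasis ℤ Λ
  have e : (Fin (Module.finrank ℤ Λ) → ZMod 2) ≃ Fin (2 ^ Module.finrank ℤ Λ) :=
    Fintype.equivFinOfCardEq (by simp [ZMod.card])
  refine ⟨fun x => e fun i => if hx : x ∈ Λ then ((b.repr ⟨x, hx⟩ i : ℤ) : ZMod 2) else 0,
    fun p hp q hq h => ?_⟩
  have h' := e.injective h
  have hdiv : ∀ i, ∃ c : ℤ, b.repr ⟨p, hp⟩ i + b.repr ⟨q, hq⟩ i = 2 * c := by
    intro i
    have h1 := congrFun h' i
    simp only [hp, hq, dif_pos] at h1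
    have h2 := (ZMod.intCast_eq_intCast_iff_dvd_sub _ _ 2).1 h1
    obtain ⟨c, hc⟩ := h2
    exact ⟨b.repr ⟨p, hp⟩ i + c, by push_cast at hc; linarith⟩
  choose c hc using hdiv
  let m : Λ := ∑ i, c i • b i
  have hm : (⟨p, hp⟩ : Λ) + ⟨q, hq⟩ = (2 : ℤ) • m := by
    rw [← b.sum_repr ⟨p, hp⟩, ← b.sum_repr ⟨q, hq⟩, ← Finset.sum_add_distrib, Finset.smul_sum]
    refine Finset.sum_congr rfl fun i _ => ?_
    rw [← add_smul, smul_smul, hc]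
  have hm' : p + q = (2 : ℤ) • (m : E) := by
    have := congrArg (Subtype.val) hm
    simpa using this
  have : midpoint ℝ p q = m := by
    rw [midpoint_eq_smul_add, hm', ← Int.cast_smul_eq_zsmul ℝ, smul_smul, invOf_eq_inv]
    norm_num
  rw [this]
  exact m.2

/-- Take the points of `Λ` in a closed ball: finite by discreteness, and the ball is convex. -/
theorem AddSubgroup.exists_finset_of_isBounded (Λ : AddSubgroup E) [DiscreteTopology Λ]
    {F : Set E} (hF : Bornology.IsBounded F) : ∃ S : Finset E, (∀ x ∈ Λ, x ∈ F → x ∈ S) ∧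
      (∀ x ∈ S, x ∈ Λ) ∧ ∀ p ∈ S, ∀ q ∈ S, midpoint ℝ p q ∈ Λ → midpoint ℝ p q ∈ S := by
  classical
  obtain ⟨R, hR⟩ := hF.subset_closedBall 0
  have hfin : (Metric.closedBall (0 : E) R ∩ Λ).Finite :=
    Metric.finite_isBounded_inter_isClosed DiscreteTopology.isDiscrete Metric.isBounded_closedBall
      (AddSubgroup.isClosed_of_discrete)
  refine ⟨hfin.toFinset, ?_, ?_, ?_⟩
  · intro x hx hxF
    simpa using ⟨by simpa using hR hxF, hx⟩
  · intro x hx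
    exact ((Set.Finite.mem_toFinset _).1 hx).2
  · intro p hp q hq h
    rw [Set.Finite.mem_toFinset] at hp hq ⊢
    exact ⟨(convex_closedBall (0 : E) R).midpoint_mem hp.1 hq.1, h⟩

/-- Doignon's theorem for a discrete subgroup. -/
theorem AddSubgroup.doignon (Λ : AddSubgroup E) [DiscreteTopology Λ] {ι : Type*} [Finite ι]
    [Nonempty ι] (M : ι → Set E) (hM : ∀ i, Convex ℝ (M i)) (hΛ : ∀ x ∈ Λ, ∃ i, x ∉ M i) :
    ∃ φ : Fin (2 ^ Module.finrank ℤ Λ) → ι, ∀ x ∈ Λ, ∃ k, x ∉ M (φ k) := by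
  by_contra hcon
  push Not at hcon
  choose p hpΛ hpM using hcon
  -- Each selection `φ` has a witness `p φ` against it. Shrinking every `M i` to the hull of its
  -- witnesses makes it compact, while no selection starts to work.
  let M' : ι → Set E := fun i => convexHull ℝ (p '' {φ | ∃ k, φ k = i})
  have hM' : ∀ i, M' i ⊆ M i := by
    intro i
    refine convexHull_min ?_ (hM i)
    rintro _ ⟨φ, ⟨k, rfl⟩, rfl⟩
    exact hpM φ k
  obtain ⟨π, hπ⟩ := Λ.exists_parity_map
  obtain ⟨S, hS1, hS2, hS3⟩ := Λ.exists_finset_of_isBounded (Set.finite_range p).isBounded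
  obtain ⟨φ, A, -, hA, hAS⟩ := exists_convex_cover_finset S π
    (fun x hx y hy h => hS3 x hx y hy (hπ x (hS2 x hx) y (hS2 y hy) h)) M'
    (fun i => convex_convexHull ℝ _) (fun i => (Set.toFinite _).isCompact_convexHull (𝕜 := ℝ))
    (fun s hs => (hΛ s (hS2 s hs)).imp fun i hi h => hi (hM' i h))
  obtain ⟨k, hk⟩ := hAS (p φ) (hS1 _ (hpΛ _) ⟨_, rfl⟩)
  exact Set.disjoint_left.1 (hA k) hk
    (subset_convexHull ℝ _ ⟨φ, ⟨k, rfl⟩, rfl⟩)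

/-- A discrete subgroup of rank `r` that misses a convex set `M` is covered by `2 ^ r` convex sets
that miss `M`. -/
theorem AddSubgroup.exists_convex_cover (Λ : AddSubgroup E) [DiscreteTopology Λ] {M : Set E}
    (hM : Convex ℝ M) (hΛ : ∀ x ∈ Λ, x ∉ M) :
    ∃ A : Fin (2 ^ Module.finrank ℤ Λ) → Set E, (∀ k, Convex ℝ (A k)) ∧
      (∀ k, Disjoint (A k) M) ∧ ∀ x ∈ Λ, ∃ k, x ∈ A k := by
  classical
  obtain ⟨π, hπ⟩ := Λ.exists_parity_map
  have hfin : ∀ F : Finset Λ, ∃ g : Λ → Fin (2 ^ Module.finrank ℤ Λ), ∀ G ⊆ F,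
      (∃ k, ∀ x ∈ G, g x = k) → Disjoint (convexHull ℝ (((↑) : Λ → E) '' G)) M := by
    intro F
    have hpt : ∀ G : Finset Λ, ∃ y, ¬ Disjoint (convexHull ℝ (((↑) : Λ → E) '' G)) M →
        y ∈ convexHull ℝ (((↑) : Λ → E) '' G) ∧ y ∈ M := by
      intro G
      by_cases h : Disjoint (convexHull ℝ (((↑) : Λ → E) '' G)) M
      · exact ⟨0, fun h' => (h' h).elim⟩
      · obtain ⟨y, hy⟩ := Set.not_disjoint_iff.1 h
        exact ⟨y, fun _ => hy⟩
    choose y hy using hpt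
    -- One point of `M` for each bad `G ⊆ F`: missing the compact hull of these finitely many points
    -- is enough to rule out every bad monochromatic `G`.
    let Y : Set E := y '' {G | G ∈ F.powerset ∧
      ¬ Disjoint (convexHull ℝ (((↑) : Λ → E) '' G)) M}
    have hYfin : Y.Finite := (F.powerset.finite_toSet.subset fun G hG => hG.1).image _
    have hYM : convexHull ℝ Y ⊆ M := by
      refine convexHull_min ?_ hM
      rintro _ ⟨G, hG, rfl⟩
      exact (hy G hG.2).2
    obtain ⟨S, hS1, hS2, hS3⟩ := Λ.exists_finset_of_isBounded
      ((F.finite_toSet.image ((↑) : Λ → E)).isBounded)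
    obtain ⟨-, A, hAc, hA, hAS⟩ := exists_convex_cover_finset S π
      (fun x hx y hy h => hS3 x hx y hy (hπ x (hS2 x hx) y (hS2 y hy) h))
      (fun _ : Unit => convexHull ℝ Y) (fun _ => convex_convexHull ℝ _)
      (fun _ => hYfin.isCompact_convexHull (𝕜 := ℝ)) (fun s hs => ⟨(), fun h => hΛ s (hS2 s hs) (hYM h)⟩)
    have hex : ∀ x : Λ, ∃ k, x ∈ F → (x : E) ∈ A k := by
      intro x
      by_cases hx : x ∈ F
      · obtain ⟨k, hk⟩ := hAS x (hS1 x x.2 ⟨x, hx, rfl⟩)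
        exact ⟨k, fun _ => hk⟩
      · exact ⟨π 0, fun h => (hx h).elim⟩
    choose g hg using hex
    refine ⟨g, fun G hGF ⟨k, hk⟩ => ?_⟩
    by_contra hnd
    obtain ⟨h1, -⟩ := hy G hnd
    refine Set.disjoint_left.1 (hA k) (convexHull_min ?_ (hAc k) h1)
      (subset_convexHull ℝ _ ⟨G, ⟨Finset.mem_powerset.2 hGF, hnd⟩, rfl⟩)
    rintro _ ⟨x, hx, rfl⟩
    rw [← hk x hx]
    exact hg x (hGF hx)
  choose g hg using hfin
  -- Compactness: `χ` agrees on each finite set with the coloring of some larger finite set, and a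
  -- point of a convex hull already lies in the hull of a finite subset.
  obtain ⟨χ, hχ⟩ := Finset.rado_selection g
  refine ⟨fun k => convexHull ℝ (((↑) : Λ → E) '' {x | χ x = k}), fun k => convex_convexHull ℝ _,
    fun k => ?_, fun x hx => ⟨χ ⟨x, hx⟩, subset_convexHull ℝ _ ⟨⟨x, hx⟩, rfl, rfl⟩⟩⟩
  rw [Set.disjoint_left]
  intro x hx hxM
  beta_reduce at hx
  rw [convexHull_eq_union_convexHull_finite_subsets] at hx
  simp only [Set.mem_iUnion] at hx
  obtain ⟨t, ht, hxt⟩ := hx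
  obtain ⟨G, hG, rfl⟩ := Finset.subset_set_image_iff.1 ht
  obtain ⟨F, hGF, hF⟩ := hχ G
  refine Set.disjoint_left.1 (hg F G hGF ⟨k, fun z hz => ?_⟩) (by simpa using hxt) hxM
  rw [← hF z hz]
  exact hG hz

end Lattice

/-! ### Helly numbers -/

section Helly

variable {E : Type*} [NormedAddCommGroup E] [NormedSpace ℝ E] [FiniteDimensional ℝ E]

/-- Helly's theorem relative to a convex set `T`, with the dimension of `T` in place of that of the
ambient space. -/
theorem Convex.helly_relative {ι : Type*} [Finite ι] [Nonempty ι] {T : Set E} (hT : Convex ℝ T)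
    (K : ι → Set E) (hK : ∀ i, Convex ℝ (K i)) (h : ∀ x ∈ T, ∃ i, x ∉ K i) :
    ∃ J : Fin (Module.finrank ℝ (vectorSpan ℝ T) + 1) → ι, ∀ x ∈ T, ∃ i, x ∉ K (J i) := by
  classical
  have := Fintype.ofFinite ι
  by_contra hcon
  push Not at hcon
  obtain ⟨c, hc, -⟩ := hcon fun _ => Classical.arbitrary ι
  let f : vectorSpan ℝ T →ᵃ[ℝ] E := (vectorSpan ℝ T).subtype.toAffineMap + AffineMap.const ℝ _ c
  have hf : ∀ w, f w = (w : E) + c := fun w => rfl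
  obtain ⟨w, hw⟩ := Convex.helly_theorem' (𝕜 := ℝ) (F := fun i => f ⁻¹' (K i ∩ T))
    (s := Finset.univ) (fun i _ => ((hK i).inter hT).affine_preimage f) (by
      intro I _ hI
      obtain ⟨φ, hφ⟩ := Finset.exists_fin_map_of_card_le hI
      obtain ⟨x, hx, hxK⟩ := hcon φ
      refine ⟨⟨x - c, vsub_mem_vectorSpan ℝ hx hc⟩, ?_⟩
      simp only [Set.mem_iInter, Set.mem_preimage, hf, sub_add_cancel]
      intro i hi
      obtain ⟨k, rfl⟩ := hφ i hi
      exact ⟨hxK k, hx⟩)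
  simp only [Set.mem_iInter, Set.mem_preimage] at hw
  obtain ⟨i, hi⟩ := h (f w) (hw (Classical.arbitrary ι) (Finset.mem_univ _)).2
  exact hi (hw i (Finset.mem_univ _)).1

theorem AddSubgroup.helly_convex_add (Λ : AddSubgroup E) [DiscreteTopology Λ] {C : Set E}
    (hC : Convex ℝ C) {ι : Type*} [Finite ι] [Nonempty ι] (K : ι → Set E)
    (hK : ∀ i, Convex ℝ (K i)) (h : ∀ x ∈ C + (Λ : Set E), ∃ i, x ∉ K i) :
    ∃ J : Fin ((Module.finrank ℝ (vectorSpan ℝ C) + 1) * 2 ^ Module.finrank ℤ Λ) → ι,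
      ∀ x ∈ C + (Λ : Set E), ∃ i, x ∉ K (J i) := by
  -- `l ∉ M J` says exactly that the sets selected by `J` have no common point in `C + l`.
  let M : (Fin (Module.finrank ℝ (vectorSpan ℝ C) + 1) → ι) → Set E :=
    fun J => (⋂ i, K (J i)) - C
  obtain ⟨φ, hφ⟩ := Λ.doignon M (fun J => (convex_iInter fun i => hK (J i)).sub hC) (by
    intro l hl
    obtain ⟨J, hJ⟩ := hC.helly_relative (fun i => (fun x => x + l) ⁻¹' K i)
      (fun i => (hK i).translate_preimage_left l) (fun x hx => h (x + l) (Set.add_mem_add hx hl))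
    refine ⟨J, ?_⟩
    rintro ⟨y, hy, c, hc, rfl⟩
    obtain ⟨i, hi⟩ := hJ c hc
    apply hi
    simpa using Set.mem_iInter.1 hy i)
  refine ⟨fun i => φ (finProdFinEquiv.symm i).2 (finProdFinEquiv.symm i).1, ?_⟩
  rintro _ ⟨c, hc, l, hl, rfl⟩
  obtain ⟨k, hk⟩ := hφ l hl
  by_contra hcon
  push Not at hcon
  refine hk ⟨c + l, Set.mem_iInter.2 fun i => ?_, c, hc, by simp⟩
  simpa using hcon (finProdFinEquiv (i, k))

end Helly

/-! ### Facets of polyhedra and of maximal `S`-free sets -/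

section Facets

variable {d : ℕ}

theorem IsFullDim.vectorSpan_eq_top {A : Set (EuclideanSpace ℝ (Fin d))} (hA : IsFullDim A) :
    vectorSpan ℝ A = ⊤ :=
  Submodule.eq_top_of_finrank_eq (by rw [finrank_euclideanSpace_fin]; exact hA.2)

theorem IsFullDim.interior_nonempty {A : Set (EuclideanSpace ℝ (Fin d))} (hA : IsFullDim A)
    (hc : Convex ℝ A) : (interior A).Nonempty := by
  rw [hc.interior_nonempty_iff_affineSpan_eq_top,
    AffineSubspace.affineSpan_eq_top_iff_vectorSpan_eq_top_of_nonempty ℝ _ _ hA.1]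
  exact hA.vectorSpan_eq_top

theorem StrongDual.eq_zero_of_forall_le_of_mem_interior {E : Type*} [NormedAddCommGroup E]
    [NormedSpace ℝ E] {P : Set E} {l : StrongDual ℝ E} {x : E} (hx : x ∈ interior P)
    (h : ∀ y ∈ P, l y ≤ l x) : l = 0 :=
  IsLocalMax.hasFDerivAt_eq_zero (f := l) (a := x)
    (Filter.mem_of_superset (mem_interior_iff_mem_nhds.1 hx) h) l.hasFDerivAt

/-- A facet of a full-dimensional polyhedron is cut out by turning one of the defining inequalities
into an equation. -/
theorem IsFacet.exists_eq_inter {m : ℕ} {u : Fin m → EuclideanSpace ℝ (Fin d)} {β : Fin m → ℝ}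
    {P F : Set (EuclideanSpace ℝ (Fin d))} (hP : P = {x | ∀ i, inner ℝ (u i) x ≤ β i})
    (hfull : IsFullDim P) (hF : IsFacet P F) :
    ∃ i, F = {x ∈ P | inner ℝ (u i) x = β i} := by
  obtain ⟨⟨x₀, hx₀⟩, hexp, hdim⟩ := hF
  have hPc : Convex ℝ P := by
    have : P = ⋂ i, {x | inner ℝ (u i) x ≤ β i} := by rw [hP]; ext; simp
    rw [this]
    exact convex_iInter fun i => convex_halfSpace_le (innerSL ℝ (u i)).isLinear _
  have hFc : Convex ℝ F := hexp.convex hPc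
  obtain ⟨l, rfl⟩ := hexp ⟨x₀, hx₀⟩
  have hl : l ≠ 0 := by
    rintro rfl
    have : {x ∈ P | ∀ y ∈ P, (0 : StrongDual ℝ _) y ≤ (0 : StrongDual ℝ _) x} = P := by
      ext; simp
    rw [this] at hdim
    omega
  set F := {x ∈ P | ∀ y ∈ P, l y ≤ l x} with hFdef
  have hPi : ∀ x ∈ P, ∀ i, inner ℝ (u i) x ≤ β i := fun x hx => by rw [hP] at hx; exact hx
  -- Otherwise, averaging points of `F` that are strict for the separate constraints gives a point
  -- of `F` interior to `P`, where `l` is maximal, forcing `l = 0`.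
  have hact : ∃ i, u i ≠ 0 ∧ ∀ y ∈ F, inner ℝ (u i) y = β i := by
    by_contra hcon
    push Not at hcon
    have hy : ∀ i, ∃ y ∈ F, u i ≠ 0 → inner ℝ (u i) y < β i := by
      intro i
      by_cases hi : u i = 0
      · exact ⟨x₀, hx₀, fun h => (h hi).elim⟩
      · obtain ⟨y, hy, hne⟩ := hcon i hi
        exact ⟨y, hy, fun _ => lt_of_le_of_ne (hPi y hy.1 i) hne⟩
    choose y hyF hy using hy
    -- The extra point `x₀` keeps the average meaningful when `m = 0`.
    let z : Option (Fin m) → EuclideanSpace ℝ (Fin d) := fun o => o.elim x₀ y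
    have hzF : ∀ o, z o ∈ F := by rintro (_ | i) <;> simp [z, hx₀, hyF]
    let w : ℝ := ((m : ℝ) + 1)⁻¹
    have hw : 0 < w := by positivity
    have hw1 : ∑ _o : Option (Fin m), w = 1 := by
      simp only [Finset.sum_const, Finset.card_univ, Fintype.card_option, Fintype.card_fin,
        nsmul_eq_mul, w]
      push_cast
      exact mul_inv_cancel₀ (by positivity)
    let x := ∑ o, w • z o
    have hxF : x ∈ F := hFc.sum_mem (fun _ _ => hw.le) hw1 fun o _ => hzF o
    have hxlt : ∀ i, u i ≠ 0 → inner ℝ (u i) x < β i := by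
      intro i hi
      have h1 : inner ℝ (u i) x = ∑ o, w * inner ℝ (u i) (z o) := by
        simp only [x, inner_sum, inner_smul_right]
      have h2 : β i = ∑ _o : Option (Fin m), w * β i := by
        rw [← Finset.sum_mul, hw1, one_mul]
      rw [h1, h2]
      refine Finset.sum_lt_sum (fun o _ => mul_le_mul_of_nonneg_left (hPi _ (hzF o).1 i) hw.le)
        ⟨some i, Finset.mem_univ _, mul_lt_mul_of_pos_left (hy i hi) hw⟩
    have hint : x ∈ interior P := by
      refine mem_interior.2 ⟨{z | ∀ i, u i ≠ 0 → inner ℝ (u i) z < β i}, ?_, ?_, hxlt⟩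
      · intro z hz
        rw [hP]
        intro i
        by_cases hi : u i = 0
        · have := hPi x₀ hx₀.1 i
          rw [hi, inner_zero_left] at this ⊢
          exact this
        · exact (hz i hi).le
      · have : {z | ∀ i, u i ≠ 0 → inner ℝ (u i) z < β i} =
            ⋂ i, {z | u i ≠ 0 → inner ℝ (u i) z < β i} := by ext; simp
        rw [this]
        refine isOpen_iInter_of_finite fun i => ?_
        by_cases hi : u i = 0
        · simp [hi]
        · simpa [hi] using! isOpen_lt (by fun_prop : Continuous fun z => inner ℝ (u i) z)
            continuous_const
    exact hl (StrongDual.eq_zero_of_forall_le_of_mem_interior hint hxF.2)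
  obtain ⟨i, hi, hFi⟩ := hact
  refine ⟨i, ?_⟩
  -- Both spaces have dimension `d - 1`. Hence `l`, constant on `F`, is constant on the whole
  -- hyperplane of the active constraint.
  have hspan : vectorSpan ℝ F = (innerSL ℝ (u i)).toLinearMap.ker := by
    refine Submodule.eq_of_le_of_finrank_eq ?_ ?_
    · rw [vectorSpan_def, Submodule.span_le]
      rintro _ ⟨a, ha, b, hb, rfl⟩
      simp [inner_sub_right, hFi a ha, hFi b hb]
    · have h1 : Module.finrank ℝ (vectorSpan ℝ F) + 1 = d := hdim.trans hfull.2
      have h2 := Module.Dual.finrank_ker_add_one_of_ne_zero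
        (f := (innerSL ℝ (u i)).toLinearMap) (by
          intro h0
          have := LinearMap.congr_fun h0 (u i)
          simp at this
          exact hi this)
      rw [finrank_euclideanSpace_fin] at h2
      omega
  have hker : vectorSpan ℝ F ≤ l.toLinearMap.ker := by
    rw [vectorSpan_def, Submodule.span_le]
    rintro _ ⟨a, ha, b, hb, rfl⟩
    have := le_antisymm (hb.2 a ha.1) (ha.2 b hb.1)
    simp [this]
  refine Set.Subset.antisymm (fun x hx => ⟨hx.1, hFi x hx⟩) fun x hx => ⟨hx.1, fun y hy => ?_⟩
  have hmem : x - x₀ ∈ vectorSpan ℝ F := by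
    rw [hspan]
    simp [inner_sub_right, hx.2, hFi x₀ hx₀]
  have h0 : l (x - x₀) = 0 := hker hmem
  rw [map_sub, sub_eq_zero] at h0
  rw [h0]
  exact hx₀.2 y hy

theorem encard_isFacet_le {m : ℕ} {u : Fin m → EuclideanSpace ℝ (Fin d)} {β : Fin m → ℝ}
    {P : Set (EuclideanSpace ℝ (Fin d))} (hP : P = {x | ∀ i, inner ℝ (u i) x ≤ β i})
    (hfull : IsFullDim P) : {F | IsFacet P F}.encard ≤ m := by
  calc {F | IsFacet P F}.encard
      ≤ (Set.range fun i => {x ∈ P | inner ℝ (u i) x = β i}).encard := by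
        refine Set.encard_le_encard fun F hF => ?_
        obtain ⟨i, hi⟩ := IsFacet.exists_eq_inter hP hfull hF
        exact ⟨i, hi.symm⟩
    _ ≤ (Set.univ : Set (Fin m)).encard := by
        rw [← Set.image_univ]; exact Set.encard_image_le _ _
    _ = m := by simp

/-- If `S` is covered by `m` convex sets that miss the interior of a full-dimensional maximal
`S`-free set `L`, then `L` is a polyhedron given by `m` inequalities. -/
theorem IsMaximalSFree.exists_eq_halfspaces {S L : Set (EuclideanSpace ℝ (Fin d))}
    (hL : IsMaximalSFree S L) (hfull : IsFullDim L) {m : ℕ}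
    (B : Fin m → Set (EuclideanSpace ℝ (Fin d))) (hB : ∀ k, Convex ℝ (B k))
    (hBL : ∀ k, Disjoint (interior L) (B k)) (hS : ∀ x ∈ S, ∃ k, x ∈ B k) :
    ∃ (u : Fin m → EuclideanSpace ℝ (Fin d)) (β : Fin m → ℝ),
      L = {x | ∀ i, inner ℝ (u i) x ≤ β i} := by
  obtain ⟨-, hLc, -⟩ := hL.prop
  have hint := hfull.interior_nonempty hLc
  have hsep : ∀ k, ∃ (f : StrongDual ℝ (EuclideanSpace ℝ (Fin d))) (b : ℝ),
      (∀ x ∈ L, f x ≤ b) ∧ Disjoint (interior {x | f x ≤ b}) (B k) := by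
    intro k
    obtain hk | hk := (B k).eq_empty_or_nonempty
    -- An empty `B k` needs no separation; the trivial inequality keeps the count at `m`.
    · exact ⟨0, 0, by simp, by simp [hk]⟩
    · obtain ⟨f, b, hf, h1, h2⟩ :=
        geometric_hahn_banach_of_nonempty_interior hLc (hB k) (hBL k) hint hk
      refine ⟨f, b, h1, Set.disjoint_left.2 fun x hx hxB => hf ?_⟩
      exact StrongDual.eq_zero_of_forall_le_of_mem_interior hx
        fun y hy => le_trans hy (h2 x hxB)
  choose f b hfL hfB using hsep
  refine ⟨fun k => (InnerProductSpace.toDual ℝ _).symm (f k), b, ?_⟩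
  simp only [InnerProductSpace.toDual_symm_apply]
  -- The intersection of the half-spaces contains `L` and is itself `S`-free, so maximality gives
  -- equality.
  refine hL.eq_of_subset ⟨?_, ?_, ?_⟩ fun x hx k => hfL k x hx
  · have : {x | ∀ k, f k x ≤ b k} = ⋂ k, {x | f k x ≤ b k} := by ext; simp
    rw [this]
    exact isClosed_iInter fun k => isClosed_le (f k).continuous continuous_const
  · have : {x | ∀ k, f k x ≤ b k} = ⋂ k, {x | f k x ≤ b k} := by ext; simp
    rw [this]
    exact convex_iInter fun k => convex_halfSpace_le (f k).isLinear _
  · rw [Set.disjoint_left]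
    intro x hx hxS
    obtain ⟨k, hk⟩ := hS x hxS
    refine Set.disjoint_left.1 (hfB k) (interior_mono ?_ hx) hk
    exact fun y hy => hy k

theorem facetBound_convex_add_inter {C D : Set (EuclideanSpace ℝ (Fin d))} (hC : Convex ℝ C)
    (hD : Convex ℝ D) (Λ : AddSubgroup (EuclideanSpace ℝ (Fin d))) [DiscreteTopology Λ] :
    FacetBound ((C + (Λ : Set (EuclideanSpace ℝ (Fin d)))) ∩ D) (2 ^ Module.finrank ℤ Λ) := by
  intro L hL hfull
  obtain ⟨-, hLc, hdisj⟩ := hL.prop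
  obtain ⟨A, hA, hAM, hAΛ⟩ := Λ.exists_convex_cover (M := interior L ∩ D - C)
    ((hLc.interior.inter hD).sub hC) (by
      rintro l hl ⟨x, hx, c, hc, rfl⟩
      exact Set.disjoint_left.1 hdisj hx.1 ⟨⟨c, hc, x - c, hl, by simp⟩, hx.2⟩)
  obtain ⟨u, β, hu⟩ := hL.exists_eq_halfspaces hfull (fun k => D ∩ (C + A k))
    (fun k => hD.inter (hC.add (hA k))) (by
      intro k
      rw [Set.disjoint_left]
      rintro x hx ⟨hxD, c, hc, a, ha, rfl⟩
      exact Set.disjoint_left.1 (hAM k) ha ⟨c + a, ⟨hx, hxD⟩, c, hc, by simp⟩) (by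
      rintro _ ⟨⟨c, hc, l, hl, rfl⟩, hxD⟩
      obtain ⟨k, hk⟩ := hAΛ l hl
      exact ⟨k, hxD, c, hc, l, hk, rfl⟩)
  exact ⟨⟨_, u, β, hu⟩, encard_isFacet_le hu hfull⟩

theorem hellyProp_convex_add_inter {C D : Set (EuclideanSpace ℝ (Fin d))} (hC : Convex ℝ C)
    (hD : Convex ℝ D) (Λ : AddSubgroup (EuclideanSpace ℝ (Fin d))) [DiscreteTopology Λ] :
    HellyProp {A | ∃ K : Set (EuclideanSpace ℝ (Fin d)), Convex ℝ K ∧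
      A = ((C + (Λ : Set (EuclideanSpace ℝ (Fin d)))) ∩ D) ∩ K}
      ((affDim C + 1) * 2 ^ Module.finrank ℤ Λ) := by
  intro m hm F hF hempty
  choose K hK hFK using hF
  have : Nonempty (Fin m) := ⟨⟨0, hm⟩⟩
  -- Absorbing `D` into each convex set reduces to `C + Λ` without changing the bound.
  obtain ⟨J, hJ⟩ := Λ.helly_convex_add hC (fun i => D ∩ K i) (fun i => hD.inter (hK i)) (by
    intro x hx
    by_contra hcon
    push Not at hcon
    have : x ∈ ⋂ i, F i := Set.mem_iInter.2 fun i => by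
      rw [hFK i]
      exact ⟨⟨hx, (hcon i).1⟩, (hcon i).2⟩
    rw [hempty] at this
    exact this)
  refine ⟨J, Set.eq_empty_iff_forall_notMem.2 fun x hx => ?_⟩
  have hx' := fun i => (hFK (J i)) ▸ Set.mem_iInter.1 hx i
  have hpos : 0 < (affDim C + 1) * 2 ^ Module.finrank ℤ Λ := by positivity
  obtain ⟨i, hi⟩ := hJ x (hx' ⟨0, hpos⟩).1.1
  exact hi ⟨(hx' i).1.2, (hx' i).2⟩

end Facets

theorem theorem4 (d : ℕ) (C D : Set (EuclideanSpace ℝ (Fin d)))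
    (hC : Convex ℝ C) (hCne : C.Nonempty) (hD : Convex ℝ D) (hDne : D.Nonempty)
    (Λ : AddSubgroup (EuclideanSpace ℝ (Fin d))) (hΛ : DiscreteTopology Λ) :
    sConvexHelly ((C + (Λ : Set (EuclideanSpace ℝ (Fin d)))) ∩ D) ≤
        (((affDim C + 1) * 2 ^ Module.finrank ℤ Λ : ℕ) : ℕ∞) ∧
      facetComplexity ((C + (Λ : Set (EuclideanSpace ℝ (Fin d)))) ∩ D) ≤
        (((2 ^ Module.finrank ℤ Λ : ℕ) : ℕ∞) : WithBot ℕ∞) := by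
  constructor
  · unfold sConvexHelly hellyNumber
    split_ifs
    · exact zero_le
    · exact iInf₂_le (α := ℕ∞) _
        ⟨Nat.one_le_iff_ne_zero.2 (by positivity), hellyProp_convex_add_inter hC hD Λ⟩
  · unfold facetComplexity
    split_ifs
    · exact WithBot.coe_le_coe.2
        (iInf₂_le (α := ℕ∞) _ (facetBound_convex_add_inter hC hD Λ))
    · exact bot_le
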